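/- A camera is a real $3\times 4$ matrix of rank three; its focus is the unique point of $\mathbb{P}^3_{\mathbb{R}}$ in its kernel. Let $\mathcal{A}=(A_1,\ldots,A_n)$ be an arrangement of cameras with foci $\mathbf{c}_1,\ldots,\mathbf{c}_n$, and let $\varphi_{\mathcal{A}}:\mathbb{P}^3_{\mathbb{R}}\smallsetminus\{\mathbf{c}_1,\ldots,\mathbf{c}_n\}\to(\mathbb{P}^2_{\mathbb{R}})^n$ be the map $\mathbf{q}\mapsto(A_1\mathbf{q},\ldots,A_n\mathbf{q})$. The multiview ideal $M_{\mathcal{A}}\subseteq\mathbb{C}[p_1,\ldots,p_n]$, where $p_i=(x_i,y_i,z_i)$, is the ideal of all polynomials that vanish on the image of $\varphi_{\mathcal{A}}$, viewed as a subset of $(\mathbb{P}^2_{\mathbb{C}})^n$ (that is, vanish at all homogeneous coordinates of every point of the image). For $\sigma=\{\sigma_1<\cdots<\sigma_k\}\subseteq\{1,\ldots,n\}$ let $$\mathcal{A}_\sigma(p)=\begin{pmatrix}A_{\sigma_1}&p_{\sigma_1}&0&\cdots&0\\ A_{\sigma_2}&0&p_{\sigma_2}&\cdots&0\\ \vdots&\vdots&&\ddots&\vdots\\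 A_{\sigma_k}&0&0&\cdots&p_{\sigma_k}\end{pmatrix},$$ a matrix of size $3k\times(4+k)$, and let the $k$-focal ideal $H^k_{\mathcal{A}}\subseteq\mathbb{C}[p_1,\ldots,p_n]$ be the ideal generated by the $(4+k)\times(4+k)$ minors of all the matrices $\mathcal{A}_\sigma(p)$ with $|\sigma|=k$. Theorem. If the foci of the cameras in $\mathcal{A}$ are pairwise distinct, then $M_{\mathcal{A}}=H^2_{\mathcal{A}}+H^3_{\mathcal{A}}$; that is, the multiview ideal is generated by the bifocal and trifocal polynomials. -/

import Mathlib

open scoped LinearAlgebra.Projectivization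

noncomputable section

namespace Multiview

/-- A (general projective) camera: a real `3 × 4` matrix of rank three. -/
structure Camera where
  mat : Matrix (Fin 3) (Fin 4) ℝ
  rank_eq : mat.rank = 3

namespace Camera

theorem finrank_ker (A : Camera) : Module.finrank ℝ (LinearMap.ker A.mat.mulVecLin) = 1 := by
  have h := LinearMap.finrank_range_add_finrank_ker A.mat.mulVecLin
  have h2 : Module.finrank ℝ (LinearMap.range A.mat.mulVecLin) = 3 := A.rank_eq
  rw [h2, Module.finrank_fin_fun] at h
  omega

/-- The focal point of a camera: the unique point of `ℙ³(ℝ)` in the kernel of its matrix. -/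
def focus (A : Camera) : ℙ ℝ (Fin 4 → ℝ) :=
  Projectivization.mk'' (LinearMap.ker A.mat.mulVecLin) A.finrank_ker

theorem mulVec_rep_ne_zero (A : Camera) {q : ℙ ℝ (Fin 4 → ℝ)} (hq : q ≠ A.focus) :
    A.mat.mulVec q.rep ≠ 0 := by
  intro h
  apply hq
  apply Projectivization.submodule_injective
  rw [focus, Projectivization.submodule_mk'']
  apply Submodule.eq_of_le_of_finrank_eq
  · rw [Projectivization.submodule_eq, Submodule.span_singleton_le_iff_mem]
    exact h
  · rw [Projectivization.finrank_submodule, A.finrank_ker]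

/-- The image `A q ∈ ℙ²(ℝ)` of a world point `q ∈ ℙ³(ℝ)` different from the focal point. -/
def image (A : Camera) (q : ℙ ℝ (Fin 4 → ℝ)) (hq : q ≠ A.focus) : ℙ ℝ (Fin 3 → ℝ) :=
  Projectivization.mk ℝ (A.mat.mulVec q.rep) (A.mulVec_rep_ne_zero hq)

end Camera

/-- The image formation map `φ_A`, from the points of `ℙ³(ℝ)` other than the foci to
`(ℙ²(ℝ))ⁿ`. -/
def imageFormation {n : ℕ} (A : Fin n → Camera)
    (q : {q : ℙ ℝ (Fin 4 → ℝ) // ∀ i, q ≠ (A i).focus}) : Fin n → ℙ ℝ (Fin 3 → ℝ) :=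
  fun i => (A i).image q.1 (q.2 i)

/-- The coordinatewise inclusion `ℝ³ → ℂ³`, semilinear over `ℝ → ℂ`. -/
def complexify : (Fin 3 → ℝ) →ₛₗ[Complex.ofRealHom] (Fin 3 → ℂ) where
  toFun v := fun a => (v a : ℂ)
  map_add' v w := by ext a; simp
  map_smul' c v := by ext a; simp

theorem complexify_injective : Function.Injective complexify := by
  intro v w h
  ext a
  exact Complex.ofReal_injective (congrFun h a)

/-- The inclusion `ℙ²(ℝ) ⊆ ℙ²(ℂ)`. -/
def complexPoint : ℙ ℝ (Fin 3 → ℝ) → ℙ ℂ (Fin 3 → ℂ) :=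
  Projectivization.map complexify complexify_injective

/-- The joint image `φ_A(ℙ³(ℝ))`, as a set of points of `(ℙ²(ℂ))ⁿ`. -/
def jointImage {n : ℕ} (A : Fin n → Camera) : Set (Fin n → ℙ ℂ (Fin 3 → ℂ)) :=
  Set.range fun q => fun i => complexPoint (imageFormation A q i)

/-- The ring `ℂ[p₁, …, pₙ]`; the variables `(i, 0), (i, 1), (i, 2)` are `xᵢ, yᵢ, zᵢ`. -/
abbrev ImageRing (n : ℕ) : Type := MvPolynomial (Fin n × Fin 3) ℂ

/-- A polynomial vanishes at a point of `(ℙ²(ℂ))ⁿ` if it vanishes at every choice of homogeneous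
coordinates of that point. -/
def VanishesAt {n : ℕ} (f : ImageRing n) (P : Fin n → ℙ ℂ (Fin 3 → ℂ)) : Prop :=
  ∀ (v : Fin n → Fin 3 → ℂ) (hv : ∀ i, v i ≠ 0),
    (∀ i, Projectivization.mk ℂ (v i) (hv i) = P i) →
      MvPolynomial.eval (fun x => v x.1 x.2) f = 0

/-- The vanishing ideal of a set of points of `(ℙ²(ℂ))ⁿ`. -/
def vanishingIdeal {n : ℕ} (S : Set (Fin n → ℙ ℂ (Fin 3 → ℂ))) : Ideal (ImageRing n) where
  carrier := {f | ∀ P ∈ S, VanishesAt f P}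
  add_mem' {f g} hf hg P hP v hv h := by
    rw [map_add, hf P hP v hv h, hg P hP v hv h, add_zero]
  zero_mem' P _ v _ _ := map_zero _
  smul_mem' c f hf P hP v hv h := by
    rw [smul_eq_mul, map_mul, hf P hP v hv h, mul_zero]

/-- The multiview ideal `M_A`: the vanishing ideal of the joint image. -/
def multiviewIdeal {n : ℕ} (A : Fin n → Camera) : Ideal (ImageRing n) :=
  vanishingIdeal (jointImage A)

/-- The partially symbolic `3k × (4 + k)` matrix `A_σ(p)`, `k = |σ|`: the block row of `i ∈ σ` has
`A_i` in the first four columns, the vector `p_i` in the column of `i`, and zeros elsewhere. -/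
def focalMatrix {n : ℕ} (A : Fin n → Camera) (σ : Finset (Fin n)) :
    Matrix (σ × Fin 3) (Fin 4 ⊕ σ) (ImageRing n) :=
  Matrix.of fun r c =>
    match c with
    | Sum.inl b => MvPolynomial.C (((A r.1).mat r.2 b : ℝ) : ℂ)
    | Sum.inr j => if r.1 = j then MvPolynomial.X ((r.1 : Fin n), r.2) else 0

/-- The ideal generated by the minors of `M` that use all columns (its maximal minors, when `M` has
at least as many rows as columns). The rows are chosen by an injection, so each minor is listed
together with its reorderings, which differ from it by a sign. -/
def maximalMinors {m c R : Type*} [Fintype c] [DecidableEq c] [CommRing R] (M : Matrix m c R) :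
    Ideal R :=
  Ideal.span (Set.range fun r : c ↪ m => (M.submatrix r id).det)

/-- The `k`-focal ideal `H_A^k`: the sum over all `k`-element sets `σ` of cameras of the ideals of
maximal minors of `A_σ(p)`. -/
def focalIdeal {n : ℕ} (A : Fin n → Camera) (k : ℕ) : Ideal (ImageRing n) :=
  ∑ σ ∈ Finset.powersetCard k (Finset.univ : Finset (Fin n)), maximalMinors (focalMatrix A σ)

end Multiview

end

/-!
The closure of the joint image is parametrized by `p i = λ i • A i *ᵥ q`, and the real points are
dense in the parameter space, so the multiview ideal is the kernel of this parametrization `param`.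
That the bifocal and trifocal polynomials generate the kernel is proved by induction on the
multidegree of a polynomial `f`. If `f` has positive degree in the `i₀`-th image, choose a plane of
the world through the focus of `A i₀` and through no other focus. It projects to a line `z = 0` of
the `i₀`-th image. In suitable image coordinates, the restriction of `param` to the plane is the
monomial map `p i a ↦ λ i * q a` with `p i₀ 0 = z` replaced by zero. Its kernel is generated, in the
multidegrees positive in `i₀`, by `z` and binomials which are focal polynomials modulo `z`. So `f`
is a sum of focal polynomials and a multiple `g * z`; as the kernel is prime and does not contain
`z`, the induction hypothesis applies to `g`.
-/

noncomputable section

namespace Multiview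

open MvPolynomial Module
open scoped Matrix

section LinearAlgebra

variable {κ m n K : Type*} [Field K]

theorem exists_isUnit_forall_row_eq [Finite κ] [Fintype m] [DecidableEq m] {e : κ → m}
    (he : Function.Injective e) {v : κ → m → K} (hv : LinearIndependent K v) :
    ∃ G : Matrix m m K, IsUnit G ∧ ∀ k, G (e k) = v k := by
  classical
  cases nonempty_fintype κ
  let b := Basis.sumExtend hv
  have hb (k : κ) : b (Sum.inl k) = v k := by
    change b (Sum.inl k) = ((Equiv.ofInjective v hv.injective k : Set.range v) : m → K)
    simp only [b, Basis.sumExtend, Basis.reindex_apply, Basis.extend_apply_self]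
    rfl
  have : Finite (κ ⊕ Basis.sumExtendIndex hv) := Module.Finite.finite_basis b
  have : Fintype (Basis.sumExtendIndex hv) := @Fintype.ofFinite _ (Finite.sum_right κ)
  have hcard : Fintype.card (Basis.sumExtendIndex hv) = Fintype.card ↥(Set.range e)ᶜ := by
    have h := finrank_eq_card_basis b
    rw [finrank_fintype_fun_eq_card, Fintype.card_sum] at h
    rw [Fintype.card_compl_set, Set.card_range_of_injective he]
    lia
  let φ : κ ⊕ Basis.sumExtendIndex hv ≃ m :=
    ((Equiv.ofInjective e he).sumCongr (Fintype.equivOfCardEq hcard)).trans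
      (Equiv.Set.sumCompl (Set.range e))
  refine ⟨Matrix.of fun i => b (φ.symm i), ?_, fun k => ?_⟩
  · exact Matrix.linearIndependent_rows_iff_isUnit.1 (b.linearIndependent.comp _ φ.symm.injective)
  · change b (φ.symm (φ (Sum.inl k))) = v k
    rw [φ.symm_apply_apply, hb]

theorem exists_forall_dotProduct_ne_zero {ι : Type*} [Infinite K] [Finite ι] [Fintype m]
    {v : ι → m → K} (hv : ∀ i, v i ≠ 0) : ∃ r, ∀ i, r ⬝ᵥ v i ≠ 0 := by
  classical
  obtain ⟨f, hf⟩ := Module.exists_dual_forall_apply_ne_zero (K := K) v hv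
  obtain ⟨r, rfl⟩ := (dotProductEquiv K m).surjective f
  exact ⟨r, hf⟩

variable [Fintype m] [Fintype n]

theorem exists_vecMul_eq_of_forall_dotProduct_eq_zero {M : Matrix m n K} {g : n → K}
    (h : ∀ v, M *ᵥ v = 0 → g ⬝ᵥ v = 0) : ∃ r, r ᵥ* M = g := by
  classical
  have hmem : dotProductEquiv K n g ∈ LinearMap.range M.mulVecLin.dualMap := by
    rw [LinearMap.range_dualMap_eq_dualAnnihilator_ker, Submodule.mem_dualAnnihilator]
    exact h
  obtain ⟨f, hf⟩ := hmem
  obtain ⟨r, rfl⟩ := (dotProductEquiv K m).surjective f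
  refine ⟨r, (dotProductEquiv K n).injective (LinearMap.ext fun v => ?_)⟩
  rw [← hf]
  exact (Matrix.dotProduct_mulVec r M v).symm

theorem exists_mul_eq_one_of_forall_mulVec_eq_zero [DecidableEq n] {M : Matrix m n K}
    (h : ∀ v, M *ᵥ v = 0 → v = 0) : ∃ L : Matrix n m K, L * M = 1 := by
  choose L hL using fun b : n =>
    exists_vecMul_eq_of_forall_dotProduct_eq_zero (M := M) (g := Pi.single b 1) fun v hv => by
      rw [h v hv, dotProduct_zero]
  refine ⟨Matrix.of L, ?_⟩
  ext b c
  exact (congrFun (hL b) c).trans (by simp only [Matrix.one_apply, Pi.single_apply, eq_comm])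

omit [Fintype m] in
theorem eq_zero_of_map_mulVec_eq_zero [Finite m] {S : Type*} [CommRing S] (φ : K →+* S)
    {M : Matrix m n K} (h : ∀ v, M *ᵥ v = 0 → v = 0) {v : n → S} (hv : M.map φ *ᵥ v = 0) :
    v = 0 := by
  classical
  cases nonempty_fintype m
  obtain ⟨L, hL⟩ := exists_mul_eq_one_of_forall_mulVec_eq_zero h
  rw [← Matrix.one_mulVec v, ← Matrix.map_one φ (map_zero φ) (map_one φ), ← hL,
    Matrix.map_mul, ← Matrix.mulVec_mulVec, hv, Matrix.mulVec_zero]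

theorem exists_ne_zero_forall_mulVec_eq_zero {M : Matrix m n K} (hM : LinearIndependent K M.row)
    (hcard : Fintype.card n = Fintype.card m + 1) :
    ∃ c ≠ 0, M *ᵥ c = 0 ∧ ∀ v, M *ᵥ v = 0 → ∃ t : K, t • c = v := by
  have hker : finrank K (LinearMap.ker M.mulVecLin) = 1 := by
    have h := LinearMap.finrank_range_add_finrank_ker M.mulVecLin
    rw [← Matrix.rank, hM.rank_matrix, finrank_fintype_fun_eq_card, hcard] at h
    exact Nat.add_left_cancel h
  obtain ⟨c, hc, hspan⟩ := finrank_eq_one_iff'.1 hker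
  refine ⟨c, fun h => hc (Subtype.ext h), c.2, fun v hv => ?_⟩
  obtain ⟨t, ht⟩ := hspan ⟨v, hv⟩
  exact ⟨t, congrArg Subtype.val ht⟩

theorem exists_isUnit_forall_row_dotProduct_ne_zero {ι : Type*} [DecidableEq m]
    [Infinite K] [Finite ι] [Nonempty ι] {v : ι → m → K} (hv : ∀ i, v i ≠ 0) (a : m) :
    ∃ P : Matrix m m K, IsUnit P ∧ ∀ i, P a ⬝ᵥ v i ≠ 0 := by
  obtain ⟨r, hr⟩ := exists_forall_dotProduct_ne_zero hv
  have hr0 : r ≠ 0 := fun h => hr (Classical.arbitrary ι) (by rw [h, zero_dotProduct])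
  obtain ⟨P, hP, hPr⟩ := exists_isUnit_forall_row_eq (e := fun _ : Unit => a) (v := fun _ => r)
    (Function.injective_of_subsingleton _) (LinearIndependent.of_subsingleton () hr0)
  exact ⟨P, hP, fun i => by rw [hPr ()]; exact hr i⟩

theorem exists_vecMul_eq_add_smul {M : Matrix m n K}
    {c : n → K} (hc : ∀ v, M *ᵥ v = 0 → ∃ t : K, t • c = v) {h : n → K} (hh : h ⬝ᵥ c ≠ 0)
    (g : n → K) : ∃ (r : m → K) (α : K), r ᵥ* M = g + α • h := by
  obtain ⟨r, hr⟩ := exists_vecMul_eq_of_forall_dotProduct_eq_zero (M := M)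
    (g := g + (-(g ⬝ᵥ c / h ⬝ᵥ c)) • h) fun v hv => by
      obtain ⟨t, rfl⟩ := hc v hv
      rw [dotProduct_smul, add_dotProduct, smul_dotProduct, smul_eq_mul (-_), neg_mul,
        div_mul_cancel₀ _ hh, add_neg_cancel, smul_zero]
  exact ⟨r, _, hr⟩

end LinearAlgebra

section MaximalMinors

variable {m m' b c c' l R : Type*} [CommRing R]
  [Fintype b] [DecidableEq b] [Fintype c] [DecidableEq c] [Fintype l] [DecidableEq l]

theorem det_mul_eq_sum_det_submatrix [Fintype m] (N : Matrix c m R) (M : Matrix m c R) :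
    (N * M).det = ∑ r : c → m, (∏ x, N x (r x)) * (M.submatrix r id).det := by
  classical
  have hrows : N * M = fun x => ∑ k, N x k • M k := by
    ext x y
    simp [Matrix.mul_apply]
  calc (N * M).det
      = Matrix.detRowAlternating.toMultilinearMap (fun x => ∑ k, N x k • M k) := by
        rw [hrows]; rfl
    _ = _ := by
        rw [MultilinearMap.map_sum]
        exact Finset.sum_congr rfl fun r _ =>
          MultilinearMap.map_smul_univ _ (fun x => N x (r x)) (fun x => M (r x))

theorem det_mul_mem_maximalMinors [Fintype m] (N : Matrix c m R) (M : Matrix m c R) :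
    (N * M).det ∈ maximalMinors M := by
  rw [det_mul_eq_sum_det_submatrix]
  refine Ideal.sum_mem _ fun r _ => Ideal.mul_mem_left _ _ ?_
  by_cases hr : Function.Injective r
  · exact Ideal.subset_span ⟨⟨r, hr⟩, rfl⟩
  · obtain ⟨x, y, hxy, hne⟩ := Function.not_injective_iff.1 hr
    rw [Matrix.det_zero_of_row_eq hne (by ext z; simp [hxy])]
    exact Ideal.zero_mem _

theorem det_mul_mem_maximalMinors_fromCols [Fintype m] {L : Matrix b m R} {B : Matrix m b R}
    {D : Matrix l m R} (hL : L * B = 1) (hD : D * B = 0) (Y : Matrix m l R) :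
    (D * Y).det ∈ maximalMinors (Matrix.fromCols B Y) := by
  have h := det_mul_mem_maximalMinors (Matrix.fromRows L D) (Matrix.fromCols B Y)
  rwa [Matrix.fromRows_mul_fromCols, hL, hD, Matrix.det_fromBlocks_zero₂₁, Matrix.det_one,
    one_mul] at h

theorem maximalMinors_submatrix_le (M : Matrix m c R) (e₁ : m' ↪ m) (e₂ : c' ≃ c)
    [Fintype c'] [DecidableEq c'] : maximalMinors (M.submatrix e₁ e₂) ≤ maximalMinors M := by
  refine Ideal.span_le.2 ?_
  rintro _ ⟨r, rfl⟩
  refine Ideal.subset_span ⟨e₂.symm.toEmbedding.trans (r.trans e₁), ?_⟩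
  refine (Matrix.det_submatrix_equiv_self e₂ _).symm.trans (congrArg Matrix.det ?_)
  ext x y
  simp

theorem maximalMinors_submatrix (M : Matrix m c R) (e₁ : m' ≃ m) (e₂ : c' ≃ c)
    [Fintype c'] [DecidableEq c'] : maximalMinors (M.submatrix e₁ e₂) = maximalMinors M := by
  refine le_antisymm (maximalMinors_submatrix_le M e₁.toEmbedding e₂) ?_
  simpa using maximalMinors_submatrix_le (M.submatrix e₁ e₂) e₁.symm.toEmbedding e₂.symm

end MaximalMinors

section MultifocalIdeal

variable {ι κ β l σ R : Type*} [CommRing R]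

/-- The linear form `∑ a, r a * X (x a)` with coefficient vector `r` in the variables `X (x a)`. -/
def linearForm [Fintype κ] (x : κ → σ) : (κ → R) →ₗ[R] MvPolynomial σ R :=
  Fintype.linearCombination R fun a => X (x a)

theorem linearForm_apply [Fintype κ] (x : κ → σ) (r : κ → R) :
    linearForm x r = ∑ a, r a • X (x a) := rfl

/-- The matrix `(M_{s j} | p_{s j})` of a family `s` of projections `M i` to spaces with
coordinates `κ`; for cameras and `s` the inclusion of a finite set `σ` this is `A_σ(p)`. -/
def multifocalMatrix [DecidableEq l] (M : ι → Matrix κ β R) (s : l → ι) :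
    Matrix (l × κ) (β ⊕ l) (MvPolynomial (ι × κ) R) :=
  Matrix.fromCols (Matrix.of fun x b => C (M (s x.1) x.2 b))
    (Matrix.of fun x j => if x.1 = j then X (s x.1, x.2) else 0)

/-- The ideal of the `k`-focal polynomials of a family of projections `M i`, the analogue of
`focalIdeal`. -/
def multifocalIdeal [Fintype β] [DecidableEq β] (M : ι → Matrix κ β R) (k : ℕ) :
    Ideal (MvPolynomial (ι × κ) R) :=
  ⨆ s : Fin k ↪ ι, maximalMinors (multifocalMatrix M s)

theorem maximalMinors_le_multifocalIdeal [Fintype l] [DecidableEq l] [Fintype β] [DecidableEq β]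
    (M : ι → Matrix κ β R) (s : l ↪ ι) :
    maximalMinors (multifocalMatrix M s) ≤ multifocalIdeal M (Fintype.card l) := by
  let e := (Fintype.equivFin l).symm
  rw [← maximalMinors_submatrix _ (e.prodCongr (Equiv.refl κ)) ((Equiv.refl β).sumCongr e)]
  refine le_trans (le_of_eq ?_) (le_iSup _ (e.toEmbedding.trans s))
  congr 1
  ext1 x y
  rcases y with b | j <;> simp [multifocalMatrix]

theorem det_linearForm_mem_maximalMinors {K : Type*} [Field K] [Fintype κ] [Fintype l]
    [DecidableEq l] [Fintype β] [DecidableEq β] {M : ι → Matrix κ β K} {s : l → ι}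
    (hker : ∀ v, (∀ j, M (s j) *ᵥ v = 0) → v = 0) {D : l → l → κ → K}
    (hD : ∀ y, ∑ j, D y j ᵥ* M (s j) = 0) :
    (Matrix.of fun y j => linearForm (s j, ·) (D y j)).det ∈
      maximalMinors (multifocalMatrix M s) := by
  let B : Matrix (l × κ) β K := Matrix.of fun x b => M (s x.1) x.2 b
  obtain ⟨L, hL⟩ : ∃ L : Matrix β (l × κ) K, L * B = 1 :=
    exists_mul_eq_one_of_forall_mulVec_eq_zero fun v hv =>
      hker v fun j => funext fun a => congrFun hv (j, a)
  let D' : Matrix l (l × κ) K := Matrix.of fun y x => D y x.1 x.2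
  have hDB : D' * B = 0 := by
    ext y b
    have := congrFun (hD y) b
    simpa [D', B, Matrix.mul_apply, Fintype.sum_prod_type, Matrix.vecMul, dotProduct] using this
  have key := det_mul_mem_maximalMinors_fromCols (L := L.map C) (B := B.map C) (D := D'.map C)
    (by rw [← Matrix.map_mul, hL, Matrix.map_one _ C_0 C_1])
    (by rw [← Matrix.map_mul, hDB, Matrix.map_zero _ C_0])
    (Matrix.of fun x j => if x.1 = j then X (s x.1, x.2) else 0 :
      Matrix (l × κ) l (MvPolynomial (ι × κ) K))
  refine (congrArg (Matrix.det · ∈ maximalMinors (multifocalMatrix M s)) ?_).mpr key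
  ext1 y j
  simp [Matrix.mul_apply, Fintype.sum_prod_type, D', linearForm_apply, smul_eq_C_mul]

theorem det_linearForm_mem_multifocalIdeal {K : Type*} [Field K] [Fintype κ] [Fintype β]
    [DecidableEq β] {M : ι → Matrix κ β K} {k : ℕ} {s : Fin k → ι} (hs : Function.Injective s)
    (hker : ∀ v, (∀ j, M (s j) *ᵥ v = 0) → v = 0) {D : Fin k → Fin k → κ → K}
    (hD : ∀ y, ∑ j, D y j ᵥ* M (s j) = 0) :
    (Matrix.of fun y j => linearForm (s j, ·) (D y j)).det ∈ multifocalIdeal M k :=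
  le_iSup (fun s : Fin k ↪ ι => maximalMinors (multifocalMatrix M s)) ⟨s, hs⟩
    (det_linearForm_mem_maximalMinors hker hD)

end MultifocalIdeal

section MonomialMap

variable {σ τ R : Type*} [CommRing R]

theorem exists_eq_single_one_add {m : σ →₀ ℕ} {x : σ} (h : m x ≠ 0) :
    ∃ p, m = Finsupp.single x 1 + p :=
  ⟨m - Finsupp.single x 1, (add_tsub_cancel_of_le (Finsupp.single_le_iff.2
    (Nat.one_le_iff_ne_zero.2 h))).symm⟩

theorem monomial_single_one_add (x : σ) (m : σ →₀ ℕ) :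
    monomial (Finsupp.single x 1 + m) (1 : R) = X x * monomial m 1 := by
  rw [monomial_single_add, pow_one]

theorem mem_of_map_eq_zero_of_forall_monomial {I : Ideal (MvPolynomial σ R)}
    {φ : MvPolynomial σ R →ₗ[R] MvPolynomial τ R} {f : MvPolynomial σ R}
    (hφ : ∀ m, φ (monomial m 1) = 0 ∨ ∃ e, φ (monomial m 1) = monomial e 1)
    (hzero : ∀ m ∈ f.support, φ (monomial m 1) = 0 → monomial m 1 ∈ I)
    (hcongr : ∀ m ∈ f.support, ∀ m' ∈ f.support, φ (monomial m 1) = φ (monomial m' 1) →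
      monomial m 1 - monomial m' 1 ∈ I) (hf : φ f = 0) : f ∈ I := by
  classical
  let lift (e : τ →₀ ℕ) : MvPolynomial σ R ⧸ I :=
    if h : ∃ m ∈ f.support, φ (monomial m 1) = monomial e 1
    then Ideal.Quotient.mk I (monomial h.choose 1) else 0
  let L : MvPolynomial τ R →ₗ[R] MvPolynomial σ R ⧸ I := (basisMonomials τ R).constr R lift
  have hL (e : τ →₀ ℕ) : L (monomial e 1) = lift e :=
    (basisMonomials τ R).constr_basis R lift e
  have hmonomial : ∀ m ∈ f.support,
      Ideal.Quotient.mkₐ R I (monomial m 1) = L (φ (monomial m 1)) := by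
    intro m hm
    obtain h | ⟨e, he⟩ := hφ m
    · rw [h, map_zero]
      exact Ideal.Quotient.eq_zero_iff_mem.2 (hzero m hm h)
    · have hex : ∃ m ∈ f.support, φ (monomial m 1) = monomial e 1 := ⟨m, hm, he⟩
      rw [he, hL]
      simp only [lift, dif_pos hex]
      exact Ideal.Quotient.eq.2
        (hcongr m hm _ hex.choose_spec.1 (he.trans hex.choose_spec.2.symm))
  have hfL : Ideal.Quotient.mkₐ R I f = L (φ f) := by
    have hsum : f = ∑ m ∈ f.support, coeff m f • monomial m 1 := by
      simp [smul_monomial]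
    rw [hsum]
    simp only [map_sum, map_smul]
    exact Finset.sum_congr rfl fun m hm => by rw [hmonomial m hm]
  rw [hf, map_zero] at hfL
  exact Ideal.Quotient.eq_zero_iff_mem.1 hfL

end MonomialMap

section LadderIdeal

variable {ι κ R : Type*} [CommRing R] {i₀ : ι} {c₀ : κ}

/-- The row sums of an exponent matrix, as a multidegree in `ℕ^ι`. -/
def rowDegree : (ι × κ →₀ ℕ) →+ (ι →₀ ℕ) := Finsupp.mapDomain.addMonoidHom Prod.fst

/-- The column sums of an exponent matrix, as a multidegree in `ℕ^κ`. -/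
def colDegree : (ι × κ →₀ ℕ) →+ (κ →₀ ℕ) := Finsupp.mapDomain.addMonoidHom Prod.snd

@[simp]
theorem rowDegree_single (x : ι × κ) (k : ℕ) :
    rowDegree (Finsupp.single x k) = Finsupp.single x.1 k := Finsupp.mapDomain_single

@[simp]
theorem colDegree_single (x : ι × κ) (k : ℕ) :
    colDegree (Finsupp.single x k) = Finsupp.single x.2 k := Finsupp.mapDomain_single

theorem exists_apply_ne_zero_of_mapDomain_ne_zero {σ τ : Type*} {m : σ →₀ ℕ} {f : σ → τ} {y : τ}
    (h : m.mapDomain f y ≠ 0) : ∃ x, f x = y ∧ m x ≠ 0 := by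
  classical
  obtain ⟨x, hx, rfl⟩ :=
    Finset.mem_image.1 (Finsupp.mapDomain_support (Finsupp.mem_support_iff.2 h))
  exact ⟨x, rfl, Finsupp.mem_support_iff.1 hx⟩

theorem rowDegree_ne_zero_iff {m : ι × κ →₀ ℕ} {i : ι} :
    rowDegree m i ≠ 0 ↔ ∃ a, m (i, a) ≠ 0 := by
  constructor
  · intro h
    obtain ⟨⟨_, a⟩, rfl, hx⟩ := exists_apply_ne_zero_of_mapDomain_ne_zero h
    exact ⟨a, hx⟩
  · rintro ⟨a, h⟩
    obtain ⟨p, rfl⟩ := exists_eq_single_one_add h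
    simp

theorem colDegree_ne_zero_iff {m : ι × κ →₀ ℕ} {a : κ} :
    colDegree m a ≠ 0 ↔ ∃ i, m (i, a) ≠ 0 := by
  constructor
  · intro h
    obtain ⟨⟨i, _⟩, rfl, hx⟩ := exists_apply_ne_zero_of_mapDomain_ne_zero h
    exact ⟨i, hx⟩
  · rintro ⟨i, h⟩
    obtain ⟨p, rfl⟩ := exists_eq_single_one_add h
    simp

variable (R i₀ c₀) in
/-- The generators of the toric ideal of the matrix of variables `X (i, a)` with its entry
`(i₀, c₀)` replaced by zero, in the multidegrees that are positive in the row `i₀`. The minors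
that avoid the row `i₀` occur only after multiplication with an entry of that row. -/
inductive LadderGenerator : MvPolynomial (ι × κ) R → Prop
  | corner : LadderGenerator (X (i₀, c₀))
  | bifocal {i : ι} {a b : κ} (hi : i ≠ i₀) (ha : a ≠ c₀) (hb : b ≠ c₀) :
      LadderGenerator (X (i, a) * X (i₀, b) - X (i, b) * X (i₀, a))
  | trifocal {i j : ι} (hi : i ≠ i₀) (hj : j ≠ i₀) (hij : i ≠ j) (a b c : κ) :
      LadderGenerator (X (i₀, c) * (X (i, a) * X (j, b) - X (i, b) * X (j, a)))

variable (R i₀ c₀) in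
/-- The ideal generated by the polynomials of `LadderGenerator`. -/
def ladderIdeal : Ideal (MvPolynomial (ι × κ) R) := Ideal.span {f | LadderGenerator R i₀ c₀ f}

theorem LadderGenerator.mem_ladderIdeal {f : MvPolynomial (ι × κ) R}
    (h : LadderGenerator R i₀ c₀ f) : f ∈ ladderIdeal R i₀ c₀ := Ideal.subset_span h

theorem monomial_sub_swap_mem_ladderIdeal {i j : ι} {a b : κ} {m : ι × κ →₀ ℕ} (hi : i ≠ i₀)
    (hij : i ≠ j) (hj : j = i₀ → a ≠ c₀ ∧ b ≠ c₀) (hm : j ≠ i₀ → rowDegree m i₀ ≠ 0) :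
    monomial (Finsupp.single (i, a) 1 + (Finsupp.single (j, b) 1 + m)) 1 -
      monomial (Finsupp.single (i, b) 1 + (Finsupp.single (j, a) 1 + m)) 1 ∈
        ladderIdeal R i₀ c₀ := by
  by_cases hji : j = i₀
  · subst hji
    have hgen := LadderGenerator.bifocal (R := R) hi (hj rfl).1 (hj rfl).2
    convert Ideal.mul_mem_left _ (monomial m 1) hgen.mem_ladderIdeal using 1
    simp only [monomial_single_one_add]
    ring
  · obtain ⟨c, hc⟩ := rowDegree_ne_zero_iff.1 (hm hji)
    obtain ⟨p, rfl⟩ := exists_eq_single_one_add hc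
    have hgen := LadderGenerator.trifocal (R := R) (c₀ := c₀) hi hji hij a b c
    convert Ideal.mul_mem_left _ (monomial p 1) hgen.mem_ladderIdeal using 1
    simp only [monomial_single_one_add]
    ring

theorem exists_monomial_sub_single_add_mem_ladderIdeal {m : ι × κ →₀ ℕ} {i : ι} {a : κ}
    (hi : i ≠ i₀) (hrow : rowDegree m i ≠ 0) (hcol : colDegree m a ≠ 0)
    (ha : a = c₀ ∨ colDegree m c₀ = 0) (hm : m (i₀, c₀) = 0) (h₀ : rowDegree m i₀ ≠ 0) :
    ∃ p, rowDegree (Finsupp.single (i, a) 1 + p) = rowDegree m ∧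
      colDegree (Finsupp.single (i, a) 1 + p) = colDegree m ∧ p (i₀, c₀) = 0 ∧
      monomial m 1 - monomial (Finsupp.single (i, a) 1 + p) 1 ∈ ladderIdeal R i₀ c₀ := by
  by_cases hia : m (i, a) = 0
  swap
  · obtain ⟨p, rfl⟩ := exists_eq_single_one_add hia
    exact ⟨p, rfl, rfl, by simpa [hi] using hm, by simp⟩
  obtain ⟨a', ha'⟩ := rowDegree_ne_zero_iff.1 hrow
  obtain ⟨j, hja⟩ := colDegree_ne_zero_iff.1 hcol
  have hij : i ≠ j := by
    rintro rfl
    exact hja hia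
  have hswap : j = i₀ → a' ≠ c₀ ∧ a ≠ c₀ := by
    rintro rfl
    have hac : a ≠ c₀ := by
      rintro rfl
      exact hja hm
    refine ⟨?_, hac⟩
    rintro rfl
    exact colDegree_ne_zero_iff.2 ⟨i, ha'⟩ (ha.resolve_left hac)
  obtain ⟨m, rfl⟩ := exists_eq_single_one_add ha'
  obtain ⟨m, rfl⟩ : ∃ p, m = Finsupp.single (j, a) 1 + p :=
    exists_eq_single_one_add (by simpa [hij] using hja)
  refine ⟨Finsupp.single (j, a') 1 + m, by simp, by simp [add_left_comm], ?_,
    monomial_sub_swap_mem_ladderIdeal hi hij hswap fun hj => by simpa [hi, hj] using h₀⟩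
  have hne : (j, a') ≠ (i₀, c₀) := fun h =>
    (hswap (congrArg Prod.fst h)).1 (congrArg Prod.snd h)
  simp only [Finsupp.add_apply, Nat.add_eq_zero_iff] at hm
  rw [Finsupp.add_apply, Finsupp.single_eq_of_ne hne.symm, hm.2.2]

theorem eq_mapDomain_colDegree {m : ι × κ →₀ ℕ} (hm : ∀ i, i ≠ i₀ → rowDegree m i = 0) :
    m = (colDegree m).mapDomain (Prod.mk i₀) := by
  have hsupp : ∀ x ∈ m.support, x = (i₀, x.2) := by
    intro x hx
    by_contra hne
    exact rowDegree_ne_zero_iff.2 ⟨x.2, Finsupp.mem_support_iff.1 hx⟩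
      (hm x.1 fun h => hne (Prod.ext h rfl))
  calc m = m.mapDomain id := Finsupp.mapDomain_id.symm
    _ = m.mapDomain (Prod.mk i₀ ∘ Prod.snd) := Finsupp.mapDomain_congr hsupp
    _ = _ := Finsupp.mapDomain_comp

theorem exists_apply_ne_zero_of_rowDegree_ne_zero {m : ι × κ →₀ ℕ} (hm : m (i₀, c₀) = 0)
    (h : ∃ i, i ≠ i₀ ∧ rowDegree m i ≠ 0) :
    ∃ i a, i ≠ i₀ ∧ m (i, a) ≠ 0 ∧ (a = c₀ ∨ colDegree m c₀ = 0) := by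
  by_cases hcol : colDegree m c₀ = 0
  · obtain ⟨i, hi, hrow⟩ := h
    obtain ⟨a, ha⟩ := rowDegree_ne_zero_iff.1 hrow
    exact ⟨i, a, hi, ha, Or.inr hcol⟩
  · obtain ⟨i, hi⟩ := colDegree_ne_zero_iff.1 hcol
    refine ⟨i, c₀, ?_, hi, Or.inl rfl⟩
    rintro rfl
    exact hi hm

theorem monomial_sub_mem_ladderIdeal {m m' : ι × κ →₀ ℕ} (hrow : rowDegree m = rowDegree m')
    (hcol : colDegree m = colDegree m') (hm : m (i₀, c₀) = 0) (hm' : m' (i₀, c₀) = 0)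
    (h₀ : rowDegree m i₀ ≠ 0) : monomial m 1 - monomial m' 1 ∈ ladderIdeal R i₀ c₀ := by
  induction hN : m.degree using Nat.strong_induction_on generalizing m m' with
  | _ N ih =>
  by_cases h : ∃ i, i ≠ i₀ ∧ rowDegree m i ≠ 0
  · obtain ⟨i, a, hi, hia, ha⟩ := exists_apply_ne_zero_of_rowDegree_ne_zero hm h
    obtain ⟨p', hrow', hcol', hp', hmem⟩ :=
      exists_monomial_sub_single_add_mem_ladderIdeal (R := R) hi
        (hrow ▸ rowDegree_ne_zero_iff.2 ⟨a, hia⟩) (hcol ▸ colDegree_ne_zero_iff.2 ⟨i, hia⟩)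
        (hcol ▸ ha) hm' (hrow ▸ h₀)
    obtain ⟨p, rfl⟩ := exists_eq_single_one_add hia
    have hpp' : monomial p 1 - monomial p' 1 ∈ ladderIdeal R i₀ c₀ := by
      refine ih p.degree ?_ ?_ ?_ (by simpa [hi] using hm) hp' (by simpa [hi] using h₀) rfl
      · rw [← hN, map_add, Finsupp.degree_single]
        lia
      · simpa using hrow.trans hrow'.symm
      · simpa using hcol.trans hcol'.symm
    have hcancel := Ideal.mul_mem_left _ (X (i, a)) hpp'
    rw [mul_sub, ← monomial_single_one_add, ← monomial_single_one_add] at hcancel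
    simpa using sub_mem hcancel hmem
  · push Not at h
    have hmm' : m = m' := by
      rw [eq_mapDomain_colDegree h, hcol, ← eq_mapDomain_colDegree (hrow ▸ h)]
    rw [hmm', sub_self]
    exact Ideal.zero_mem _

variable [DecidableEq ι] [DecidableEq κ]

variable (R i₀ c₀) in
/-- The parametrization `X (i, a) ↦ λ i * q a` of the matrices of rank one, with the entry
`(i₀, c₀)` replaced by zero. -/
def toricMap : MvPolynomial (ι × κ) R →ₐ[R] MvPolynomial (ι ⊕ κ) R :=
  aeval fun x => if x = (i₀, c₀) then 0 else X (Sum.inl x.1) * X (Sum.inr x.2)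

theorem toricMap_monomial_of_ne_zero {m : ι × κ →₀ ℕ} (hm : m (i₀, c₀) ≠ 0) :
    toricMap R i₀ c₀ (monomial m 1) = 0 := by
  obtain ⟨p, rfl⟩ := exists_eq_single_one_add hm
  rw [monomial_single_one_add, map_mul, toricMap, aeval_X, if_pos rfl, zero_mul]

theorem toricMap_monomial_of_eq_zero {m : ι × κ →₀ ℕ} (hm : m (i₀, c₀) = 0) :
    toricMap R i₀ c₀ (monomial m 1) =
      monomial (Finsupp.sumElim (rowDegree m) (colDegree m)) 1 := by
  have hzero : toricMap R i₀ c₀ (monomial 0 1) =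
      monomial (Finsupp.sumElim (rowDegree (0 : ι × κ →₀ ℕ)) (colDegree (0 : ι × κ →₀ ℕ))) 1 := by
    have hexp : Finsupp.sumElim (0 : ι →₀ ℕ) (0 : κ →₀ ℕ) = 0 := by ext (i | a) <;> simp
    simp only [map_zero, monomial_zero', map_one, hexp]
  induction m using Finsupp.induction_linear with
  | zero => exact hzero
  | add m m' ih ih' =>
    rw [Finsupp.add_apply, Nat.add_eq_zero_iff] at hm
    rw [← one_mul (1 : R), ← monomial_mul, map_mul, ih hm.1, ih' hm.2, monomial_mul]
    congr 2
    ext (i | a) <;> simp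
  | single x k =>
    obtain rfl | hk := eq_or_ne k 0
    · rwa [Finsupp.single_zero]
    · have hx : x ≠ (i₀, c₀) := by
        rintro rfl
        exact hk (by simpa using hm)
      rw [← X_pow_eq_monomial, map_pow, toricMap, aeval_X, if_neg hx, mul_pow, X_pow_eq_monomial,
        X_pow_eq_monomial, monomial_mul, one_mul]
      congr 2
      ext (i | a) <;> simp [Finsupp.single_apply]

theorem mem_ladderIdeal_of_toricMap_eq_zero {d : ι →₀ ℕ} (hd : d i₀ ≠ 0)
    {f : MvPolynomial (ι × κ) R} (hf : ∀ m ∈ f.support, rowDegree m = d)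
    (h0 : toricMap R i₀ c₀ f = 0) : f ∈ ladderIdeal R i₀ c₀ := by
  nontriviality R
  have hmem {m : ι × κ →₀ ℕ} (hm : m (i₀, c₀) ≠ 0) : monomial m 1 ∈ ladderIdeal R i₀ c₀ := by
    obtain ⟨p, rfl⟩ := exists_eq_single_one_add hm
    rw [monomial_single_one_add]
    exact Ideal.mul_mem_right _ _ LadderGenerator.corner.mem_ladderIdeal
  have hne {m : ι × κ →₀ ℕ} (hm : m (i₀, c₀) = 0) : toricMap R i₀ c₀ (monomial m 1) ≠ 0 := by
    rw [toricMap_monomial_of_eq_zero hm]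
    simp
  refine mem_of_map_eq_zero_of_forall_monomial (φ := (toricMap R i₀ c₀).toLinearMap)
    (fun m => ?_) (fun m _ h => hmem fun hm => hne hm h) (fun m hm m' hm' h => ?_) h0
  · by_cases hm : m (i₀, c₀) = 0
    · exact Or.inr ⟨_, toricMap_monomial_of_eq_zero hm⟩
    · exact Or.inl (toricMap_monomial_of_ne_zero hm)
  · change toricMap R i₀ c₀ (monomial m 1) = toricMap R i₀ c₀ (monomial m' 1) at h
    by_cases hz : m (i₀, c₀) = 0 <;> by_cases hz' : m' (i₀, c₀) = 0
    · rw [toricMap_monomial_of_eq_zero hz, toricMap_monomial_of_eq_zero hz'] at h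
      have hexp := monomial_left_injective one_ne_zero h
      refine monomial_sub_mem_ladderIdeal ((hf m hm).trans (hf m' hm').symm) ?_ hz hz'
        (hf m hm ▸ hd)
      ext a
      simpa using DFunLike.congr_fun hexp (Sum.inr a)
    · exact absurd (h.trans (toricMap_monomial_of_ne_zero hz')) (hne hz)
    · exact absurd (h.symm.trans (toricMap_monomial_of_ne_zero hz)) (hne hz')
    · exact sub_mem (hmem hz) (hmem hz')

end LadderIdeal

section Grading

variable {σ τ R W : Type*} [CommRing R] [AddCommMonoid W]

theorem isWeightedHomogeneous_map_monomial {w : σ → W} {v : τ → W}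
    (ψ : MvPolynomial σ R →ₐ[R] MvPolynomial τ R)
    (hψ : ∀ s, IsWeightedHomogeneous v (ψ (X s)) (w s)) (m : σ →₀ ℕ) (c : R) :
    IsWeightedHomogeneous v (ψ (monomial m c)) (Finsupp.weight w m) := by
  rw [monomial_eq, map_mul, Finsupp.prod, map_prod, Finsupp.weight_apply, Finsupp.sum,
    ← algebraMap_eq, AlgHom.commutes, algebraMap_eq]
  refine IsWeightedHomogeneous.C_mul (IsWeightedHomogeneous.prod _ _ _ fun s _ => ?_) c
  rw [map_pow]
  exact (hψ s).pow _

theorem map_weightedHomogeneousComponent {w : σ → W} {v : τ → W}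
    (ψ : MvPolynomial σ R →ₐ[R] MvPolynomial τ R)
    (hψ : ∀ s, IsWeightedHomogeneous v (ψ (X s)) (w s)) (d : W) (f : MvPolynomial σ R) :
    ψ (weightedHomogeneousComponent w d f) = weightedHomogeneousComponent v d (ψ f) := by
  classical
  induction f using MvPolynomial.induction_on' with
  | monomial m c =>
    rw [weightedHomogeneousComponent_of_mem (isWeightedHomogeneous_monomial w m c rfl),
      weightedHomogeneousComponent_of_mem (isWeightedHomogeneous_map_monomial ψ hψ m c)]
    split_ifs <;> simp only [map_zero]
  | add p q hp hq => simp only [map_add, hp, hq]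

theorem isWeightedHomogeneous_map {w : σ → W} {v : τ → W}
    (ψ : MvPolynomial σ R →ₐ[R] MvPolynomial τ R)
    (hψ : ∀ s, IsWeightedHomogeneous v (ψ (X s)) (w s)) {d : W} {f : MvPolynomial σ R}
    (hf : IsWeightedHomogeneous w f d) : IsWeightedHomogeneous v (ψ f) d := by
  rw [← weightedHomogeneousComponent_eq_self hf, map_weightedHomogeneousComponent ψ hψ]
  exact weightedHomogeneousComponent_isWeightedHomogeneous _ _

theorem weightedHomogeneousComponent_add_mul [IsCancelAdd W] {w : σ → W} {e : W}
    {z : MvPolynomial σ R} (hz : IsWeightedHomogeneous w z e) (d : W) (g : MvPolynomial σ R) :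
    weightedHomogeneousComponent w (d + e) (g * z) = weightedHomogeneousComponent w d g * z := by
  classical
  induction g using MvPolynomial.induction_on' with
  | monomial m c =>
    rw [weightedHomogeneousComponent_of_mem (isWeightedHomogeneous_monomial w m c rfl),
      weightedHomogeneousComponent_of_mem
        ((isWeightedHomogeneous_monomial w m c rfl).mul hz)]
    simp only [add_left_inj]
    split_ifs <;> simp only [zero_mul]
  | add p q hp hq => simp only [map_add, add_mul, hp, hq]

theorem isWeightedHomogeneous_det {m c : Type*} [Fintype c] [DecidableEq c] {w : σ → W}
    {M : Matrix m c (MvPolynomial σ R)} {e : c → W}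
    (hM : ∀ x y, IsWeightedHomogeneous w (M x y) (e y)) (r : c → m) :
    IsWeightedHomogeneous w (M.submatrix r id).det (∑ y, e y) := by
  rw [Matrix.det_apply']
  refine IsWeightedHomogeneous.sum _ _ _ fun p _ => ?_
  have h := IsWeightedHomogeneous.C_mul (IsWeightedHomogeneous.prod Finset.univ
    (fun y => M.submatrix r id (p y) y) e fun y _ => hM _ _) ((Equiv.Perm.sign p : ℤ) : R)
  simpa using h

attribute [local instance] MvPolynomial.weightedGradedAlgebra

theorem isHomogeneous_maximalMinors [DecidableEq W] {m c : Type*} [Fintype c] [DecidableEq c]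
    {w : σ → W} {M : Matrix m c (MvPolynomial σ R)} {e : c → W}
    (hM : ∀ x y, IsWeightedHomogeneous w (M x y) (e y)) :
    (maximalMinors M).IsHomogeneous (weightedHomogeneousSubmodule R w) := by
  refine Ideal.homogeneous_span _ _ ?_
  rintro _ ⟨r, rfl⟩
  exact ⟨_, isWeightedHomogeneous_det hM r⟩

theorem exists_eq_add_mul_of_mem_sup_span [DecidableEq W] [IsCancelAdd W] {w : σ → W} {d e : W}
    {J : Ideal (MvPolynomial σ R)} (hJ : J.IsHomogeneous (weightedHomogeneousSubmodule R w))
    {f z : MvPolynomial σ R} (hz : IsWeightedHomogeneous w z e)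
    (hf : IsWeightedHomogeneous w f (d + e)) (hmem : f ∈ J ⊔ Ideal.span {z}) :
    ∃ j ∈ J, ∃ g, IsWeightedHomogeneous w g d ∧ f = j + g * z := by
  obtain ⟨j, hj, _, hgz, rfl⟩ := Submodule.mem_sup.1 hmem
  obtain ⟨g, rfl⟩ := Ideal.mem_span_singleton'.1 hgz
  refine ⟨_, weightedHomogeneousComponent_mem_of_mem R w hJ hj (d + e), _,
    weightedHomogeneousComponent_isWeightedHomogeneous d g, ?_⟩
  rw [← weightedHomogeneousComponent_add_mul hz, ← map_add, weightedHomogeneousComponent_eq_self hf]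

variable {ι κ β : Type*}

/-- The weights of the grading of `R[X (i, a)]` by `ℕ^ι`, in which `X (i, a)` has the degree of
the `i`-th basis vector. -/
def rowWeight (x : ι × κ) : ι →₀ ℕ := Finsupp.single x.1 1

theorem weight_rowWeight (m : ι × κ →₀ ℕ) : Finsupp.weight rowWeight m = rowDegree m := by
  simp [Finsupp.weight_apply, rowDegree, Finsupp.mapDomain, rowWeight]

theorem isWeightedHomogeneous_linearForm [Fintype κ] (w : σ → W) {e : W} {x : κ → σ}
    (hx : ∀ a, w (x a) = e) (r : κ → R) : IsWeightedHomogeneous w (linearForm x r) e := by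
  rw [linearForm_apply]
  refine IsWeightedHomogeneous.sum _ _ _ fun a _ => ?_
  rw [smul_eq_C_mul, ← hx a]
  exact (isWeightedHomogeneous_X R w (x a)).C_mul _

theorem isWeightedHomogeneous_rowWeight_linearForm [Fintype κ] (i : ι) (r : κ → R) :
    IsWeightedHomogeneous rowWeight (linearForm (i, ·) r) (Finsupp.single i 1) :=
  isWeightedHomogeneous_linearForm rowWeight (x := (i, ·)) (fun _ => rfl) r

theorem isHomogeneous_multifocalIdeal [DecidableEq ι] [Fintype β] [DecidableEq β]
    (M : ι → Matrix κ β R) (k : ℕ) :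
    (multifocalIdeal M k).IsHomogeneous (weightedHomogeneousSubmodule R rowWeight) := by
  refine Ideal.IsHomogeneous.iSup fun s => isHomogeneous_maximalMinors
    (e := Sum.elim (fun _ => 0) fun j => Finsupp.single (s j) 1) ?_
  rintro x (b | j)
  · exact isWeightedHomogeneous_C _ _
  · change IsWeightedHomogeneous rowWeight (if x.1 = j then X (s x.1, x.2) else 0) _
    split_ifs with h
    · rw [← h]
      exact isWeightedHomogeneous_X R rowWeight (s x.1, x.2)
    · exact isWeightedHomogeneous_zero _ _ _

end Grading

section Parametrization

variable {ι κ κ' β γ σ τ R : Type*} [CommRing R]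

theorem linearForm_one_apply [Fintype κ] [DecidableEq κ] (x : κ → σ) (a : κ) :
    linearForm x ((1 : Matrix κ κ R) a) = X (x a) := by
  simp [linearForm_apply, Matrix.one_apply]

theorem linearForm_ne_zero [Fintype κ] {x : κ → σ} (hx : Function.Injective x) {r : κ → R}
    (hr : r ≠ 0) : linearForm x r ≠ 0 := by
  classical
  obtain ⟨a, ha⟩ := Function.ne_iff.1 hr
  intro h
  apply ha
  simpa [linearForm_apply, coeff_sum, coeff_X, hx.eq_iff, Finsupp.single_left_inj] using
    congrArg (coeff (Finsupp.single (x a) 1)) h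

theorem map_linearForm [Fintype κ] [Fintype κ'] {x : κ → σ} (y : κ' → τ) (N : Matrix κ κ' R)
    (t : MvPolynomial τ R) {ψ : MvPolynomial σ R →ₐ[R] MvPolynomial τ R}
    (hψ : ∀ a, ψ (X (x a)) = t * linearForm y (N a)) (r : κ → R) :
    ψ (linearForm x r) = t * linearForm y (r ᵥ* N) := by
  simp only [linearForm_apply x, map_sum, map_smul, hψ, Matrix.vecMul_eq_sum, Finset.mul_sum,
    mul_smul_comm]

variable [Fintype β] [Fintype γ]

/-- The parametrization `p i = λ i • M i *ᵥ q` of the closure of the joint image of the projections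
`M i`, dually on coordinate rings. -/
def param (M : ι → Matrix κ β R) : MvPolynomial (ι × κ) R →ₐ[R] MvPolynomial (ι ⊕ β) R :=
  aeval fun x => X (Sum.inl x.1) * linearForm Sum.inr (M x.1 x.2)

theorem param_X (M : ι → Matrix κ β R) (x : ι × κ) :
    param M (X x) = X (Sum.inl x.1) * linearForm Sum.inr (M x.1 x.2) := aeval_X _ _

theorem param_linearForm [Fintype κ] (M : ι → Matrix κ β R) (i : ι) (r : κ → R) :
    param M (linearForm (i, ·) r) = X (Sum.inl i) * linearForm Sum.inr (r ᵥ* M i) :=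
  map_linearForm Sum.inr (M i) (X (Sum.inl i)) (fun a => param_X M (i, a)) r

theorem weightedHomogeneousComponent_mem_ker_param {M : ι → Matrix κ β R}
    {f : MvPolynomial (ι × κ) R} (hf : f ∈ RingHom.ker (param M)) (d : ι →₀ ℕ) :
    weightedHomogeneousComponent rowWeight d f ∈ RingHom.ker (param M) := by
  classical
  rw [RingHom.mem_ker] at hf ⊢
  rw [map_weightedHomogeneousComponent (v := Sum.elim (fun i => Finsupp.single i 1) fun _ => 0),
    hf, map_zero]
  intro x
  rw [param_X, ← add_zero (rowWeight x)]
  exact (isWeightedHomogeneous_X R _ (Sum.inl x.1)).mul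
    (isWeightedHomogeneous_linearForm _ (x := Sum.inr) (e := 0) (fun _ => rfl) _)

/-- The substitution of `E *ᵥ q` for the coordinates `q` of the world. -/
def worldSubst (E : Matrix β γ R) : MvPolynomial (ι ⊕ β) R →ₐ[R] MvPolynomial (ι ⊕ γ) R :=
  aeval (Sum.elim (fun i => X (Sum.inl i)) fun b => linearForm Sum.inr (E b))

theorem worldSubst_param (M : ι → Matrix κ β R) (E : Matrix β γ R)
    (f : MvPolynomial (ι × κ) R) :
    worldSubst E (param M f) = param (fun i => M i * E) f := by
  have hlin (r : β → R) : worldSubst E (linearForm (Sum.inr : β → ι ⊕ β) r) =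
      1 * linearForm Sum.inr (r ᵥ* E) :=
    map_linearForm Sum.inr E 1 (fun b => by rw [worldSubst, aeval_X, Sum.elim_inr, one_mul]) r
  have h : (worldSubst E).comp (param M) = param fun i => M i * E := by
    refine MvPolynomial.algHom_ext fun x => ?_
    rw [AlgHom.comp_apply, param_X, param_X, map_mul, hlin, one_mul, worldSubst, aeval_X,
      Sum.elim_inl, Matrix.mul_apply_eq_vecMul]
  exact DFunLike.congr_fun h f

variable [Fintype κ]

/-- The substitution of `P i *ᵥ p i` for the image coordinates `p i`. -/
def imageSubst (P : ι → Matrix κ κ R) : MvPolynomial (ι × κ) R →ₐ[R] MvPolynomial (ι × κ) R :=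
  aeval fun x => linearForm (x.1, ·) (P x.1 x.2)

theorem imageSubst_X (P : ι → Matrix κ κ R) (x : ι × κ) :
    imageSubst P (X x) = linearForm (x.1, ·) (P x.1 x.2) := aeval_X _ _

theorem isWeightedHomogeneous_imageSubst (P : ι → Matrix κ κ R) {d : ι →₀ ℕ}
    {f : MvPolynomial (ι × κ) R} (hf : IsWeightedHomogeneous rowWeight f d) :
    IsWeightedHomogeneous rowWeight (imageSubst P f) d := by
  refine isWeightedHomogeneous_map (imageSubst P) (fun x => ?_) hf
  rw [imageSubst_X]
  exact isWeightedHomogeneous_rowWeight_linearForm _ _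

theorem imageSubst_linearForm (P : ι → Matrix κ κ R) (i : ι) (r : κ → R) :
    imageSubst P (linearForm (i, ·) r) = linearForm (i, ·) (r ᵥ* P i) := by
  rw [map_linearForm (i, ·) (P i) 1 (fun a => by rw [imageSubst_X, one_mul]) r, one_mul]

theorem imageSubst_imageSubst_of_mul_eq_one [DecidableEq κ] {P Q : ι → Matrix κ κ R}
    (h : ∀ i, Q i * P i = 1) (f : MvPolynomial (ι × κ) R) :
    imageSubst P (imageSubst Q f) = f := by
  have hcomp : (imageSubst P).comp (imageSubst Q) = AlgHom.id R _ := by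
    refine MvPolynomial.algHom_ext fun x => ?_
    rw [AlgHom.comp_apply, imageSubst_X, imageSubst_linearForm, ← Matrix.mul_apply_eq_vecMul, h,
      linearForm_one_apply, AlgHom.id_apply]
  exact DFunLike.congr_fun hcomp f

theorem param_imageSubst (M : ι → Matrix κ β R) (P : ι → Matrix κ κ R)
    (f : MvPolynomial (ι × κ) R) :
    param M (imageSubst P f) = param (fun i => P i * M i) f := by
  have h : (param M).comp (imageSubst P) = param fun i => P i * M i := by
    refine MvPolynomial.algHom_ext fun x => ?_
    rw [AlgHom.comp_apply, imageSubst_X, param_linearForm, param_X, Matrix.mul_apply_eq_vecMul]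
  exact DFunLike.congr_fun h f

omit [Fintype κ] in
theorem multifocalIdeal_le_ker_param [IsDomain R] [DecidableEq β] [Nonempty β]
    (M : ι → Matrix κ β R) (k : ℕ) : multifocalIdeal M k ≤ RingHom.ker (param M) := by
  refine iSup_le fun s => Ideal.span_le.2 ?_
  rintro _ ⟨r, rfl⟩
  rw [SetLike.mem_coe, RingHom.mem_ker, AlgHom.map_det, ← Matrix.exists_mulVec_eq_zero_iff]
  let l (j : Fin k) : MvPolynomial (ι ⊕ β) R := X (Sum.inl (s j))
  have hl : ∏ j, l j ≠ 0 := Finset.prod_ne_zero_iff.2 fun j _ => X_ne_zero _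
  refine ⟨Sum.elim (fun b => (∏ j, l j) * X (Sum.inr b))
    (fun j => -∏ j' ∈ Finset.univ.erase j, l j'), fun h => ?_, funext fun c => ?_⟩
  · exact mul_ne_zero hl (X_ne_zero _) (congrFun h (Sum.inl (Classical.arbitrary β)))
  · have hsplit : l (r c).1 * ∏ j' ∈ Finset.univ.erase (r c).1, l j' = ∏ j, l j :=
      Finset.mul_prod_erase _ _ (Finset.mem_univ _)
    have hrow : ∑ b, C (M (s (r c).1) (r c).2 b) * ((∏ j, l j) * X (Sum.inr b)) =
        (∏ j, l j) * linearForm Sum.inr (M (s (r c).1) (r c).2) := by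
      simp only [linearForm_apply, smul_eq_C_mul, Finset.mul_sum, mul_left_comm]
    simp only [Matrix.mulVec, dotProduct, multifocalMatrix, AlgHom.mapMatrix_apply,
      Matrix.map_apply, Matrix.submatrix_apply, id_eq, Fintype.sum_sum_type,
      Matrix.fromCols_apply_inl, Matrix.of_apply, algHom_C, algebraMap_eq, Sum.elim_inl, hrow,
      Matrix.fromCols_apply_inr, apply_ite (param M), param_X, map_zero, Sum.elim_inr, mul_neg,
      ite_mul, zero_mul, Finset.sum_neg_distrib, Finset.sum_ite_eq, Finset.mem_univ, if_true,
      Pi.zero_apply]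
    rw [← hsplit]
    ring

end Parametrization

section AdaptedFrame

theorem succAbove_one_of_ne_zero {d : ℕ} {a : Fin (d + 1)} (ha : a ≠ 0) :
    Fin.succAbove 1 a = a.succ :=
  Fin.succAbove_of_le_castSucc _ _ (by
    rw [Fin.le_def, Fin.val_castSucc, Fin.val_one]
    exact Fin.pos_iff_ne_zero.2 ha)

variable {ι K : Type*} [Field K] {d : ℕ} {M : ι → Matrix (Fin (d + 1)) (Fin (d + 2)) K} {i₀ : ι}

variable (M i₀) in
/-- Coordinates adapted to a hyperplane `G 1 = 0` of the world through the focus of the projection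
`M i₀` and through no other focus. The rows of `G` are linear forms on the world and the rows of
`P i` are linear forms on the `i`-th image. On the hyperplane, the image coordinates `P i` pull
back to the world coordinates `G 0, G 2, G 3, …` for all `i ≠ i₀`, and for `i = i₀` to the same
coordinates with `G 0` replaced by zero. -/
structure AdaptedFrame where
  G : Matrix (Fin (d + 2)) (Fin (d + 2)) K
  P : ι → Matrix (Fin (d + 1)) (Fin (d + 1)) K
  α : ι → Fin (d + 1) → K
  isUnit_G : IsUnit G
  vecMul_self (a : Fin (d + 1)) : P i₀ a ᵥ* M i₀ = G a.succ
  vecMul_of_ne {i : ι} (hi : i ≠ i₀) (a : Fin (d + 1)) :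
    P i a ᵥ* M i = G (Fin.succAbove 1 a) + α i a • G 1

namespace AdaptedFrame

variable (F : AdaptedFrame M i₀)

theorem vecMul_eq_vecMul {i : ι} (hi : i ≠ i₀) {a : Fin (d + 1)} (ha : a ≠ 0) :
    F.P i a ᵥ* M i = (F.P i₀ a + F.α i a • F.P i₀ 0) ᵥ* M i₀ := by
  rw [F.vecMul_of_ne hi, succAbove_one_of_ne_zero ha, Matrix.add_vecMul, Matrix.smul_vecMul,
    F.vecMul_self, F.vecMul_self, Fin.succ_zero_eq_one]

theorem vecMul_sub_vecMul {i j : ι} (hi : i ≠ i₀) (hj : j ≠ i₀) (a : Fin (d + 1)) :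
    F.P i a ᵥ* M i - F.P j a ᵥ* M j = ((F.α i a - F.α j a) • F.P i₀ 0) ᵥ* M i₀ := by
  rw [F.vecMul_of_ne hi, F.vecMul_of_ne hj, Matrix.smul_vecMul, F.vecMul_self,
    Fin.succ_zero_eq_one, sub_smul]
  abel

/-- The image coordinates of an adapted frame. -/
def coord (x : ι × Fin (d + 1)) : MvPolynomial (ι × Fin (d + 1)) K := imageSubst F.P (X x)

theorem coord_eq_linearForm (i : ι) (a : Fin (d + 1)) :
    F.coord (i, a) = linearForm (i, ·) (F.P i a) := imageSubst_X _ _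

variable (hM : Pairwise fun i j => ∀ v, M i *ᵥ v = 0 → M j *ᵥ v = 0 → v = 0)

include hM

theorem bifocal_mem {i : ι} (hi : i ≠ i₀) {a b : Fin (d + 1)} (ha : a ≠ 0) (hb : b ≠ 0) :
    F.coord (i, a) * F.coord (i₀, b) - F.coord (i, b) * F.coord (i₀, a) ∈
      multifocalIdeal M 2 ⊔ Ideal.span {F.coord (i₀, 0)} := by
  have hs : Function.Injective ![i, i₀] := by
    intro x y
    fin_cases x <;> fin_cases y <;> simp [hi, hi.symm]
  let D : Fin 2 → Fin 2 → Fin (d + 1) → K :=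
    ![![-F.P i a, F.P i₀ a + F.α i a • F.P i₀ 0], ![-F.P i b, F.P i₀ b + F.α i b • F.P i₀ 0]]
  have hD (y : Fin 2) : ∑ j, D y j ᵥ* M (![i, i₀] j) = 0 := by
    fin_cases y <;> simp [D, F.vecMul_eq_vecMul hi, ha, hb, Matrix.neg_vecMul]
  have key := det_linearForm_mem_multifocalIdeal hs (fun v hv => hM hi v (hv 0) (hv 1)) hD
  refine Submodule.mem_sup.2 ⟨_, neg_mem key, (C (F.α i a) * F.coord (i, b) -
    C (F.α i b) * F.coord (i, a)) * F.coord (i₀, 0),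
    Ideal.mul_mem_left _ _ (Ideal.mem_span_singleton_self _), ?_⟩
  simp only [Nat.succ_eq_add_one, Nat.reduceAdd, Matrix.cons_val', Matrix.cons_val_fin_one,
    Matrix.det_fin_two, Fin.isValue, Matrix.of_apply, Matrix.cons_val_zero, map_neg,
    Matrix.cons_val_one, map_add, map_smul, smul_eq_C_mul, neg_mul, mul_neg, sub_neg_eq_add,
    neg_add_rev, neg_neg, coord_eq_linearForm, D]
  ring

theorem trifocal_mem {i j : ι} (hi : i ≠ i₀) (hj : j ≠ i₀) (hij : i ≠ j) (a b c : Fin (d + 1)) :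
    F.coord (i₀, c) * (F.coord (i, a) * F.coord (j, b) - F.coord (i, b) * F.coord (j, a)) ∈
      multifocalIdeal M 3 ⊔ Ideal.span {F.coord (i₀, 0)} := by
  have hz : F.coord (i₀, 0) ∈ Ideal.span {F.coord (i₀, 0)} := Ideal.mem_span_singleton_self _
  obtain rfl | hc := eq_or_ne c 0
  · exact Ideal.mem_sup_right (Ideal.mul_mem_right _ _ hz)
  have hs : Function.Injective ![i, j, i₀] := by
    intro x y
    fin_cases x <;> fin_cases y <;> simp [hi, hi.symm, hj, hj.symm, hij, hij.symm]
  let D : Fin 3 → Fin 3 → Fin (d + 1) → K :=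
    ![![F.P i a, -F.P j a, -((F.α i a - F.α j a) • F.P i₀ 0)],
      ![F.P i b, -F.P j b, -((F.α i b - F.α j b) • F.P i₀ 0)],
      ![-F.P i c, 0, F.P i₀ c + F.α i c • F.P i₀ 0]]
  have hD (y : Fin 3) : ∑ l, D y l ᵥ* M (![i, j, i₀] l) = 0 := by
    fin_cases y <;> simp [D, Fin.sum_univ_three, F.vecMul_eq_vecMul hi hc, Matrix.neg_vecMul,
      ← sub_eq_add_neg, F.vecMul_sub_vecMul hi hj]
  have key := det_linearForm_mem_multifocalIdeal hs (fun v hv => hM hi v (hv 0) (hv 2)) hD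
  refine Submodule.mem_sup.2 ⟨_, neg_mem key, (
    F.coord (i, c) * (C (F.α i a - F.α j a) * F.coord (j, b) -
      C (F.α i b - F.α j b) * F.coord (j, a)) -
    C (F.α i c) * (F.coord (i, a) * F.coord (j, b) - F.coord (i, b) * F.coord (j, a))) *
      F.coord (i₀, 0), Ideal.mul_mem_left _ _ hz, ?_⟩
  simp only [Nat.succ_eq_add_one, Nat.reduceAdd, Matrix.cons_val', Matrix.cons_val_fin_one,
    Matrix.det_fin_three, Fin.isValue, Matrix.of_apply, Matrix.cons_val_zero, Matrix.cons_val_one,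
    map_neg, mul_neg, Matrix.cons_val, map_add, map_smul, smul_eq_C_mul, neg_mul, C_sub, map_zero,
    mul_zero, sub_zero, sub_neg_eq_add, neg_neg, add_zero, neg_add_rev, coord_eq_linearForm, D]
  ring

theorem imageSubst_mem_of_mem_ladderIdeal {f : MvPolynomial (ι × Fin (d + 1)) K}
    (hf : f ∈ ladderIdeal K i₀ 0) : imageSubst F.P f ∈
      multifocalIdeal M 2 ⊔ multifocalIdeal M 3 ⊔ Ideal.span {F.coord (i₀, 0)} := by
  rw [← Ideal.mem_comap]
  refine Ideal.span_le.2 (fun g hg => ?_) hf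
  simp only [SetLike.mem_coe, Ideal.mem_comap]
  cases hg with
  | corner => exact Ideal.mem_sup_right (Ideal.mem_span_singleton_self _)
  | bifocal hi ha hb =>
    rw [map_sub, map_mul, map_mul]
    exact SetLike.le_def.1 (sup_le_sup_right le_sup_left _) (F.bifocal_mem hM hi ha hb)
  | trifocal hi hj hij a b c =>
    rw [map_mul, map_sub, map_mul, map_mul]
    exact SetLike.le_def.1 (sup_le_sup_right le_sup_right _)
      (F.trifocal_mem hM hi hj hij a b c)

omit hM

/-- A parametrization of the hyperplane `G 1 = 0` of the world by the coordinates `G a`, `a ≠ 1`. -/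
def chart : Matrix (Fin (d + 2)) (Fin (d + 1)) K := F.G⁻¹.submatrix id (Fin.succAbove 1)

theorem vecMul_chart (b : Fin (d + 2)) :
    F.G b ᵥ* F.chart = fun a => (1 : Matrix (Fin (d + 2)) _ K) b (Fin.succAbove 1 a) := by
  rw [← Matrix.mul_nonsing_inv F.G ((Matrix.isUnit_iff_isUnit_det _).1 F.isUnit_G)]
  rfl

theorem vecMul_chart_one : F.G 1 ᵥ* F.chart = 0 := by
  rw [vecMul_chart]
  exact funext fun a => Matrix.one_apply_ne' (Fin.succAbove_ne 1 a)

theorem vecMul_chart_succAbove (a : Fin (d + 1)) :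
    F.G (Fin.succAbove 1 a) ᵥ* F.chart = (1 : Matrix (Fin (d + 1)) (Fin (d + 1)) K) a := by
  rw [vecMul_chart]
  exact funext fun b => by simp only [Matrix.one_apply, Fin.succAbove_right_inj]

theorem mul_mul_chart_of_ne {i : ι} (hi : i ≠ i₀) : F.P i * M i * F.chart = 1 := by
  funext a
  rw [Matrix.mul_apply_eq_vecMul, Matrix.mul_apply_eq_vecMul, F.vecMul_of_ne hi,
    Matrix.add_vecMul, Matrix.smul_vecMul, vecMul_chart_one, vecMul_chart_succAbove, smul_zero,
    add_zero]

theorem mul_mul_chart_self (a : Fin (d + 1)) :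
    (F.P i₀ * M i₀ * F.chart) a = if a = 0 then 0 else (1 : Matrix _ _ K) a := by
  rw [Matrix.mul_apply_eq_vecMul, Matrix.mul_apply_eq_vecMul, F.vecMul_self]
  split_ifs with ha
  · rw [ha, Fin.succ_zero_eq_one, vecMul_chart_one]
  · rw [← succAbove_one_of_ne_zero ha, vecMul_chart_succAbove]

theorem param_mul_mul_chart [DecidableEq ι] :
    param (fun i => F.P i * M i * F.chart) = toricMap K i₀ (0 : Fin (d + 1)) := by
  refine MvPolynomial.algHom_ext fun ⟨i, a⟩ => ?_
  rw [param_X, toricMap, aeval_X]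
  obtain rfl | hi := eq_or_ne i i₀
  · rw [mul_mul_chart_self]
    split_ifs <;> simp_all [linearForm_one_apply]
  · rw [F.mul_mul_chart_of_ne hi, linearForm_one_apply, if_neg (by simp [hi])]

theorem exists_mul_eq_one : ∃ Q : ι → Matrix (Fin (d + 1)) (Fin (d + 1)) K,
    ∀ i, Q i * F.P i = 1 := by
  suffices h : ∀ i, ∃ Q, F.P i * Q = 1 by
    choose Q hQ using h
    exact ⟨Q, fun i => mul_eq_one_comm.1 (hQ i)⟩
  intro i
  obtain rfl | hi := eq_or_ne i i₀
  · refine ⟨M i * F.G⁻¹.submatrix id Fin.succ, ?_⟩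
    have hG : F.P i * M i = F.G.submatrix Fin.succ id := funext F.vecMul_self
    rw [← Matrix.mul_assoc, hG, ← Matrix.submatrix_mul _ _ _ _ _ Function.bijective_id,
      Matrix.mul_nonsing_inv F.G ((Matrix.isUnit_iff_isUnit_det _).1 F.isUnit_G),
      Matrix.submatrix_one _ (Fin.succ_injective _)]
  · exact ⟨M i * F.chart, by rw [← Matrix.mul_assoc, F.mul_mul_chart_of_ne hi]⟩

theorem param_coord_ne_zero : param M (F.coord (i₀, 0)) ≠ 0 := by
  rw [coord_eq_linearForm, param_linearForm, F.vecMul_self]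
  exact mul_ne_zero (X_ne_zero _) (linearForm_ne_zero Sum.inr_injective
    (Matrix.linearIndependent_rows_iff_isUnit.2 F.isUnit_G |>.ne_zero _))

theorem mem_sup_of_mem_ker_param
    (hM : Pairwise fun i j => ∀ v, M i *ᵥ v = 0 → M j *ᵥ v = 0 → v = 0) {e : ι →₀ ℕ}
    (he : e i₀ ≠ 0) {f : MvPolynomial (ι × Fin (d + 1)) K}
    (hf : IsWeightedHomogeneous rowWeight f e) (h0 : f ∈ RingHom.ker (param M)) :
    f ∈ multifocalIdeal M 2 ⊔ multifocalIdeal M 3 ⊔ Ideal.span {F.coord (i₀, 0)} := by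
  classical
  obtain ⟨Q, hQ⟩ := F.exists_mul_eq_one
  rw [← imageSubst_imageSubst_of_mul_eq_one hQ f]
  refine F.imageSubst_mem_of_mem_ladderIdeal hM (mem_ladderIdeal_of_toricMap_eq_zero he ?_ ?_)
  · intro m hm
    rw [← weight_rowWeight]
    exact isWeightedHomogeneous_imageSubst Q hf (mem_support_iff.1 hm)
  · rw [← param_mul_mul_chart, ← worldSubst_param, ← param_imageSubst,
      imageSubst_imageSubst_of_mul_eq_one hQ, RingHom.mem_ker.1 h0, map_zero]

end AdaptedFrame

theorem exists_adaptedFrame [Infinite K] [Finite ι] (hrow : ∀ i, LinearIndependent K (M i).row)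
    (hM : Pairwise fun i j => ∀ v, M i *ᵥ v = 0 → M j *ᵥ v = 0 → v = 0) (i₀ : ι) :
    Nonempty (AdaptedFrame M i₀) := by
  classical
  choose c hc0 hc hspan using fun i => exists_ne_zero_forall_mulVec_eq_zero (hrow i) (by simp)
  have : Nonempty ι := ⟨i₀⟩
  have hv (i : ι) : (if i = i₀ then Pi.single 0 1 else M i₀ *ᵥ c i) ≠ 0 := by
    split_ifs with hi
    · simp
    · exact fun h => hc0 i (hM hi _ (hc i) h)
  obtain ⟨P₀, hP₀, hne⟩ := exists_isUnit_forall_row_dotProduct_ne_zero hv 0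
  have hrows : LinearIndependent K fun a => P₀ a ᵥ* M i₀ :=
    (Matrix.linearIndependent_rows_iff_isUnit.2 hP₀).map' (M i₀).vecMulLinear
      (LinearMap.ker_eq_bot.2 (Matrix.vecMul_injective_iff.2 (hrow i₀)))
  obtain ⟨G, hG, hGrow⟩ := exists_isUnit_forall_row_eq (Fin.succ_injective _) hrows
  have hGc (i : ι) (hi : i ≠ i₀) : G 1 ⬝ᵥ c i ≠ 0 := by
    have h := hne i
    rwa [if_neg hi, Matrix.dotProduct_mulVec, ← hGrow] at h
  have hP (i : ι) : ∃ (P : Matrix (Fin (d + 1)) (Fin (d + 1)) K) (α : Fin (d + 1) → K),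
      i ≠ i₀ → ∀ a, P a ᵥ* M i = G (Fin.succAbove 1 a) + α a • G 1 := by
    by_cases hi : i = i₀
    · exact ⟨0, 0, fun h => (h hi).elim⟩
    · choose P α hPα using fun a =>
        exists_vecMul_eq_add_smul (hspan i) (hGc i hi) (G (Fin.succAbove 1 a))
      exact ⟨P, α, fun _ => hPα⟩
  choose P α hP using hP
  exact ⟨{
    G := G
    P := Function.update P i₀ P₀
    α := α
    isUnit_G := hG
    vecMul_self := fun a => by rw [Function.update_self, hGrow]
    vecMul_of_ne := fun hi a => by rw [Function.update_of_ne hi, hP _ hi] }⟩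

end AdaptedFrame

section KernelOfParam

attribute [local instance] MvPolynomial.weightedGradedAlgebra

variable {ι K : Type*} [Field K] {d : ℕ} {M : ι → Matrix (Fin (d + 1)) (Fin (d + 2)) K}

theorem isHomogeneous_multifocalIdeal_sup [DecidableEq ι] :
    (multifocalIdeal M 2 ⊔ multifocalIdeal M 3).IsHomogeneous
      (weightedHomogeneousSubmodule K rowWeight) :=
  (isHomogeneous_multifocalIdeal M 2).sup (isHomogeneous_multifocalIdeal M 3)

theorem multifocalIdeal_sup_le_ker_param :
    multifocalIdeal M 2 ⊔ multifocalIdeal M 3 ≤ RingHom.ker (param M) :=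
  sup_le (multifocalIdeal_le_ker_param M 2) (multifocalIdeal_le_ker_param M 3)

theorem eq_zero_of_isWeightedHomogeneous_zero_of_param_eq_zero
    {f : MvPolynomial (ι × Fin (d + 1)) K} (hf : IsWeightedHomogeneous rowWeight f 0)
    (h0 : param M f = 0) : f = 0 := by
  classical
  have hC : f = C (coeff 0 f) := by
    ext m
    rw [coeff_C]
    split_ifs with hm
    · rw [hm]
    · by_contra hne
      obtain ⟨⟨i, a⟩, hia⟩ := Finsupp.ne_iff.1 (Ne.symm hm)
      refine rowDegree_ne_zero_iff.2 ⟨a, hia⟩ ?_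
      rw [← weight_rowWeight, hf hne, Finsupp.zero_apply]
  rw [hC, algHom_C, algebraMap_eq, C_eq_zero] at h0
  rw [hC, h0, map_zero]

variable [Infinite K] [Finite ι] (hrow : ∀ i, LinearIndependent K (M i).row)
  (hM : Pairwise fun i j => ∀ v, M i *ᵥ v = 0 → M j *ᵥ v = 0 → v = 0)

include hrow hM

theorem mem_multifocalIdeal_sup_of_isWeightedHomogeneous {e : ι →₀ ℕ}
    {f : MvPolynomial (ι × Fin (d + 1)) K} (hf : IsWeightedHomogeneous rowWeight f e)
    (h0 : f ∈ RingHom.ker (param M)) : f ∈ multifocalIdeal M 2 ⊔ multifocalIdeal M 3 := by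
  classical
  induction hN : e.degree using Nat.strong_induction_on generalizing e f with
  | _ N ih =>
  obtain rfl | he := eq_or_ne e 0
  · rw [eq_zero_of_isWeightedHomogeneous_zero_of_param_eq_zero hf h0]
    exact zero_mem _
  obtain ⟨i₀, hi₀⟩ := Finsupp.ne_iff.1 he
  obtain ⟨F⟩ := exists_adaptedFrame hrow hM i₀
  obtain ⟨e, rfl⟩ := exists_eq_single_one_add hi₀
  have hcoord : IsWeightedHomogeneous rowWeight (F.coord (i₀, 0)) (Finsupp.single i₀ 1) := by
    rw [F.coord_eq_linearForm]
    exact isWeightedHomogeneous_rowWeight_linearForm i₀ _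
  obtain ⟨j, hj, g, hg, rfl⟩ := exists_eq_add_mul_of_mem_sup_span
    isHomogeneous_multifocalIdeal_sup hcoord (add_comm e _ ▸ hf)
    (F.mem_sup_of_mem_ker_param hM hi₀ hf h0)
  have hgker : param M g = 0 := by
    rw [RingHom.mem_ker, map_add, (multifocalIdeal_sup_le_ker_param hj :), zero_add, map_mul] at h0
    exact (mul_eq_zero.1 h0).resolve_right F.param_coord_ne_zero
  refine add_mem hj (Ideal.mul_mem_right _ _ (ih e.degree ?_ hg hgker rfl))
  rw [← hN, map_add, Finsupp.degree_single]
  exact lt_one_add _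

theorem ker_param_le_multifocalIdeal_sup :
    RingHom.ker (param M) ≤ multifocalIdeal M 2 ⊔ multifocalIdeal M 3 := by
  classical
  intro f hf
  rw [mem_iff_weightedHomogeneousComponent_mem K rowWeight isHomogeneous_multifocalIdeal_sup]
  exact fun e => mem_multifocalIdeal_sup_of_isWeightedHomogeneous hrow hM
    (weightedHomogeneousComponent_isWeightedHomogeneous e f)
    (weightedHomogeneousComponent_mem_ker_param hf e)

end KernelOfParam

section Multiview

theorem eq_zero_of_forall_mem_eval_eq_zero {σ R : Type*} [CommRing R] [IsDomain R] {S : Set R}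
    (hS : S.Infinite) {f g : MvPolynomial σ R} (hg : g ≠ 0)
    (h : ∀ x : σ → R, (∀ s, x s ∈ S) → eval x g ≠ 0 → eval x f = 0) : f = 0 := by
  refine (mul_eq_zero.1 (funext_set (fun _ => S) (fun _ => hS) fun x hx => ?_)).resolve_right hg
  rw [map_mul, map_zero, mul_eq_zero]
  exact or_iff_not_imp_right.2 (h x fun s => hx s (Set.mem_univ s))

theorem eval_param {ι κ β R : Type*} [CommRing R] [Fintype β] (M : ι → Matrix κ β R)
    (x : ι ⊕ β → R) (f : MvPolynomial (ι × κ) R) :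
    eval x (param M f) =
      eval (fun y => x (Sum.inl y.1) * (M y.1 *ᵥ fun b => x (Sum.inr b)) y.2) f := by
  simp only [param, ← coe_aeval_eq_eval, RingHom.coe_coe, ← AlgHom.comp_apply, comp_aeval]
  congr 2
  funext y
  simp [linearForm_apply, Matrix.mulVec, dotProduct]

namespace Camera

/-- The complex projection defined by a camera. -/
def cmat (A : Camera) : Matrix (Fin 3) (Fin 4) ℂ := A.mat.map Complex.ofRealHom

theorem cmat_mulVec_ofReal (A : Camera) (q : Fin 4 → ℝ) :
    (A.cmat *ᵥ fun b => (q b : ℂ)) = complexify (A.mat *ᵥ q) :=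
  funext fun a => (RingHom.map_mulVec Complex.ofRealHom A.mat q a).symm

theorem linearIndependent_cmat_row (A : Camera) : LinearIndependent ℂ A.cmat.row := by
  have hrow : LinearIndependent ℝ A.mat.row := by
    rw [linearIndependent_iff_card_eq_finrank_span, Set.finrank, ← Matrix.rank_eq_finrank_span_row,
      A.rank_eq, Fintype.card_fin]
  have hker (v : Fin 3 → ℝ) (hv : A.matᵀ *ᵥ v = 0) : v = 0 := by
    rw [Matrix.mulVec_transpose] at hv
    exact Matrix.vecMul_injective_iff.2 hrow (hv.trans (Matrix.zero_vecMul _).symm)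
  refine Matrix.vecMul_injective_iff.1 ((injective_iff_map_eq_zero A.cmat.vecMulLinear).2 ?_)
  intro v hv
  refine eq_zero_of_map_mulVec_eq_zero Complex.ofRealHom hker ?_
  rwa [Matrix.transpose_map, Matrix.mulVec_transpose]

theorem mk_eq_focus_iff (A : Camera) {v : Fin 4 → ℝ} (hv : v ≠ 0) :
    Projectivization.mk ℝ v hv = A.focus ↔ A.mat *ᵥ v = 0 := by
  refine ⟨fun h => ?_, fun h => ?_⟩
  · have hmem : v ∈ (Projectivization.mk ℝ v hv).submodule := by
      rw [Projectivization.submodule_mk]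
      exact Submodule.mem_span_singleton_self v
    rwa [h, focus, Projectivization.submodule_mk''] at hmem
  · by_contra hne
    obtain ⟨t, ht⟩ := Projectivization.exists_smul_eq_mk_rep ℝ v hv
    refine A.mulVec_rep_ne_zero hne ?_
    rw [← ht, Units.smul_def, Matrix.mulVec_smul, h, smul_zero]

theorem eq_zero_of_cmat_mulVec_eq_zero {A B : Camera} (hAB : A.focus ≠ B.focus) {v : Fin 4 → ℂ}
    (hA : A.cmat *ᵥ v = 0) (hB : B.cmat *ᵥ v = 0) : v = 0 := by
  refine eq_zero_of_map_mulVec_eq_zero Complex.ofRealHom (M := Matrix.fromRows A.mat B.mat)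
    (fun w hw => ?_) ?_
  · rw [Matrix.fromRows_mulVec] at hw
    by_contra hw0
    exact hAB (((A.mk_eq_focus_iff hw0).2 (funext fun a => congrFun hw (Sum.inl a))).symm.trans
      ((B.mk_eq_focus_iff hw0).2 (funext fun a => congrFun hw (Sum.inr a))))
  · rw [Matrix.fromRows_map, Matrix.fromRows_mulVec]
    exact funext (Sum.rec (congrFun hA) (congrFun hB))

theorem mk_eq_complexPoint_image_iff (A : Camera) {q : ℙ ℝ (Fin 4 → ℝ)} (hq : q ≠ A.focus)
    {v : Fin 3 → ℂ} (hv : v ≠ 0) : Projectivization.mk ℂ v hv = complexPoint (A.image q hq) ↔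
      ∃ t : ℂ, t • complexify (A.mat *ᵥ q.rep) = v := by
  rw [image, complexPoint, Projectivization.map_mk, Projectivization.mk_eq_mk_iff']

end Camera

variable {n : ℕ} {A : Fin n → Camera}

theorem eval_eq_zero_of_mem_multiviewIdeal {f : ImageRing n} (hf : f ∈ multiviewIdeal A)
    {q : Fin 4 → ℝ} (hq0 : q ≠ 0) (hq : ∀ i, (A i).mat *ᵥ q ≠ 0) {t : Fin n → ℂ}
    (ht : ∀ i, t i ≠ 0) :
    eval (fun x => t x.1 * complexify ((A x.1).mat *ᵥ q) x.2) f = 0 := by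
  obtain ⟨s, hs⟩ := Projectivization.exists_smul_eq_mk_rep ℝ q hq0
  refine hf _ ⟨⟨Projectivization.mk ℝ q hq0, fun i h => hq i (((A i).mk_eq_focus_iff hq0).1 h)⟩,
    rfl⟩ (fun i => t i • complexify ((A i).mat *ᵥ q))
    (fun i => smul_ne_zero (ht i) fun h => hq i (complexify_injective (h.trans (map_zero _).symm)))
    fun i => ((A i).mk_eq_complexPoint_image_iff _ _).2 ⟨t i * ((s : ℝ) : ℂ)⁻¹, ?_⟩
  have hs0 : ((s : ℝ) : ℂ) ≠ 0 := Complex.ofReal_ne_zero.2 s.ne_zero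
  rw [← hs, Units.smul_def, Matrix.mulVec_smul, map_smulₛₗ, smul_smul, Complex.ofRealHom_eq_coe,
    inv_mul_cancel_right₀ hs0]

theorem multiviewIdeal_le_ker_param :
    multiviewIdeal A ≤ RingHom.ker (param fun i => (A i).cmat) := by
  intro f hf
  let g : MvPolynomial (Fin n ⊕ Fin 4) ℂ :=
    X (Sum.inr 0) * ∏ i, param (fun i => (A i).cmat) (X (i, 0))
  have hg : g ≠ 0 := mul_ne_zero (X_ne_zero _) (Finset.prod_ne_zero_iff.2 fun i _ => by
    rw [param_X]
    exact mul_ne_zero (X_ne_zero _)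
      (linearForm_ne_zero Sum.inr_injective ((A i).linearIndependent_cmat_row.ne_zero 0)))
  refine eq_zero_of_forall_mem_eval_eq_zero
    (Set.infinite_range_of_injective Complex.ofReal_injective) hg fun x hx hgx => ?_
  choose y hy using hx
  obtain rfl : (fun s => (y s : ℂ)) = x := funext hy
  simp only [g, map_mul, map_prod, eval_X, eval_param, Camera.cmat_mulVec_ofReal, mul_ne_zero_iff,
    Finset.prod_ne_zero_iff, Finset.mem_univ, true_imp_iff] at hgx
  obtain ⟨hq, hgi⟩ := hgx
  rw [eval_param]
  simp only [Camera.cmat_mulVec_ofReal]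
  refine eval_eq_zero_of_mem_multiviewIdeal hf (q := fun b => y (Sum.inr b))
    (t := fun i => y (Sum.inl i)) (fun h => hq ?_) (fun i h => (hgi i).2 ?_) fun i => (hgi i).1
  · rw [congrFun h 0, Pi.zero_apply, Complex.ofReal_zero]
  · rw [h, map_zero, Pi.zero_apply]

theorem ker_param_le_multiviewIdeal :
    RingHom.ker (param fun i => (A i).cmat) ≤ multiviewIdeal A := by
  rintro f hf _ ⟨q, rfl⟩ v hv hmk
  choose t ht using fun i => ((A i).mk_eq_complexPoint_image_iff (q.2 i) (hv i)).1 (hmk i)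
  have h := eval_param (fun i => (A i).cmat) (Sum.elim t fun b => (q.1.rep b : ℂ)) f
  rw [RingHom.mem_ker.1 hf, map_zero] at h
  simpa [Camera.cmat_mulVec_ofReal, ← ht] using h.symm

theorem multiviewIdeal_eq_ker_param :
    multiviewIdeal A = RingHom.ker (param fun i => (A i).cmat) :=
  le_antisymm multiviewIdeal_le_ker_param ker_param_le_multiviewIdeal

theorem focalMatrix_eq_multifocalMatrix (σ : Finset (Fin n)) :
    focalMatrix A σ = multifocalMatrix (fun i => (A i).cmat) ((↑) : σ → Fin n) := by
  ext1 x y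
  rcases y with b | j <;> rfl

theorem focalIdeal_eq_multifocalIdeal (k : ℕ) :
    focalIdeal A k = multifocalIdeal (fun i => (A i).cmat) k := by
  rw [focalIdeal, Ideal.sum_eq_sup]
  refine le_antisymm (Finset.sup_le fun σ hσ => ?_) (iSup_le fun s => ?_)
  · rw [focalMatrix_eq_multifocalMatrix, ← (Finset.mem_powersetCard.1 hσ).2,
      ← Fintype.card_coe]
    exact maximalMinors_le_multifocalIdeal _ (Function.Embedding.subtype (· ∈ σ))
  · refine le_trans ?_ (Finset.le_sup (f := fun σ => maximalMinors (focalMatrix A σ))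
      (Finset.mem_powersetCard.2
        ⟨Finset.subset_univ (Finset.univ.map s), by rw [Finset.card_map, Finset.card_fin]⟩))
    let e : Fin k ≃ Finset.univ.map s := (Equiv.subtypeUnivEquiv Finset.mem_univ).symm.trans
      (Finset.univ.equivMap s)
    rw [focalMatrix_eq_multifocalMatrix,
      ← maximalMinors_submatrix _ (e.prodCongr (Equiv.refl _)) ((Equiv.refl _).sumCongr e)]
    refine le_of_eq (congrArg maximalMinors ?_)
    ext1 x y
    rcases y with b | j <;> simp [multifocalMatrix, e]

end Multiview

end Multiview

end

open scoped Matrix in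
theorem mainTheorem1_general {ι K : Type*} [Field K] [Infinite K] [Finite ι] {d : ℕ}
    {M : ι → Matrix (Fin (d + 1)) (Fin (d + 2)) K} (hrow : ∀ i, LinearIndependent K (M i).row)
    (hM : Pairwise fun i j => ∀ v, M i *ᵥ v = 0 → M j *ᵥ v = 0 → v = 0) :
    RingHom.ker (Multiview.param M) =
      Multiview.multifocalIdeal M 2 + Multiview.multifocalIdeal M 3 :=
  le_antisymm (Multiview.ker_param_le_multifocalIdeal_sup hrow hM)
    Multiview.multifocalIdeal_sup_le_ker_param

theorem mainTheorem1 {n : ℕ} (A : Fin n → Multiview.Camera)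
    (hA : Pairwise fun i j => (A i).focus ≠ (A j).focus) :
    Multiview.multiviewIdeal A = Multiview.focalIdeal A 2 + Multiview.focalIdeal A 3 := by
  rw [Multiview.multiviewIdeal_eq_ker_param, Multiview.focalIdeal_eq_multifocalIdeal,
    Multiview.focalIdeal_eq_multifocalIdeal]
  exact mainTheorem1_general (fun i => (A i).linearIndependent_cmat_row)
    fun _ _ hij _ => Multiview.Camera.eq_zero_of_cmat_mulVec_eq_zero (hA hij)
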